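/- Let $k_1,\dots,k_\ell\in\mathbb R$ and let $\hat{\mathbb O}=\mathbb O_{k_1}^{n_1}\times\dots\times\mathbb O_{k_\ell}^{n_\ell}$, where $\mathbb O_{k}^{n}$ is the standard model of the $n$-dimensional space form of curvature $k$: $\mathbb R^n$ if $k=0$, the sphere $\langle x,x\rangle=1/k$ in $\mathbb R^{n+1}$ if $k>0$, and the sheet $x_0>0$ of the hyperboloid $\langle x,x\rangle=1/k$ in the Lorentz space $\mathbb L^{n+1}$ if $k<0$. Let $\pi_i$ be the orthogonal projection of the tangent spaces of $\hat{\mathbb O}$ onto the $i$-th factor. Let $M^m$ be a Riemannian manifold with Levi-Civita connection $\nabla$ and let $f:M^m\to\hat{\mathbb O}$ be a smooth isometric immersion, with normal bundle $T^\perp M$, second fundamental form $\alpha$, normal connection $\nabla^\perp$, normal curvature tensor $\mathcal R^\perp(X,Y)\xi=\nabla^\perp_X\nabla^\perp_Y\xi-\nabla^\perp_Y\nabla^\perp_X\xi-\nabla^\perp_{[X,Y]}\xi$ and mean curvature vector $\eta=\frac1m\operatorname{tr}\alpha$. Let $\mathcal N_1(x)=\operatorname{span}\{\alpha(X,Y):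 X,Y\in T_xM\}$ be the first normal space, let $\mathcal N_1^\perp$ be its orthogonal complement in $T^\perp M$, let $\mathbf T_i:T^\perp M\to T^\perp M$ be given by $\mathbf T_i\xi=(\pi_i\xi)^\perp$ (the component normal to $f$), and let $\mathcal V_i=\ker(\mathrm{Id}-\mathbf T_i)\subset T^\perp M$. Fix $i\in\{1,\dots,\ell\}$ and suppose that $\mathcal V_i\cap\mathcal N_1^\perp$ is a smooth vector subbundle of $T^\perp M$. Then $$\nabla^\perp_X\xi\in\mathcal N_1^\perp\quad\text{for all vector fields } X \text{ and all } \xi\in\Gamma(\mathcal V_i\cap\mathcal N_1^\perp)$$ if and only if both of the following hold: (I) $(\nabla^\perp_Z\mathcal R^\perp)(X,Y,\xi)=0$ for all vector fields $X,Y,Z$ on $M$ and all $\xi\in\Gamma(\mathcal V_i\cap\mathcal N_1^\perp)$, where $$(\nabla^\perp_Z\mathcal R^\perp)(X,Y,\xi)=\nabla^\perp_Z\big(\mathcal R^\perp(X,Y)\xi\big)-\mathcal R^\perp(\nabla_ZX,Y)\xi-\mathcal R^\perp(X,\nabla_ZY)\xi-\mathcal R^\perp(X,Y)\nabla^\perp_Z\xi;$$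 (II) $\langle\nabla^\perp_X\xi,\eta\rangle=0$ for all vector fields $X$ and all $\xi\in\Gamma(\mathcal V_i\cap\mathcal N_1^\perp)$. Here $\Gamma$ denotes the smooth sections, and vector fields are smooth. -/

import Mathlib

open Bundle
open scoped Manifold ContDiff Bundle

noncomputable section

namespace SpaceFormProduct

/-! ### Semi-Euclidean spaces, space forms and their products -/

/-- `ν(κ) = 1` if `κ ≠ 0` and `ν(0) = 0`: the codimension of the model of the space form. -/
def nu (κ : ℝ) : ℕ := if κ = 0 then 0 else 1

/-- `τ(κ) = 1` if `κ < 0` and `τ(κ) = 0` otherwise: the index of the ambient space of the model. -/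
def tau (κ : ℝ) : ℕ := if κ < 0 then 1 else 0

/-- The inner product of the semi-Euclidean space `ℝ^N_t` of index `t`: the first `t` coordinates
are timelike. -/
def semiForm (t N : ℕ) : LinearMap.BilinForm ℝ (Fin N → ℝ) :=
  LinearMap.mk₂ ℝ (fun x y => ∑ j, (if j.val < t then (-1 : ℝ) else 1) * (x j * y j))
    (fun x x' y => by
      rw [← Finset.sum_add_distrib]
      exact Finset.sum_congr rfl fun j _ => by simp only [Pi.add_apply]; ring)
    (fun c x y => by
      rw [smul_eq_mul, Finset.mul_sum]
      exact Finset.sum_congr rfl fun j _ => by simp only [Pi.smul_apply, smul_eq_mul]; ring)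
    (fun x y y' => by
      rw [← Finset.sum_add_distrib]
      exact Finset.sum_congr rfl fun j _ => by simp only [Pi.add_apply]; ring)
    (fun c x y => by
      rw [smul_eq_mul, Finset.mul_sum]
      exact Finset.sum_congr rfl fun j _ => by simp only [Pi.smul_apply, smul_eq_mul]; ring)

/-- The model of the `d`-dimensional space form of curvature `κ`, inside the semi-Euclidean space
of dimension `d + ν(κ)` and index `τ(κ)`: all of `ℝ^d` if `κ = 0`, the sphere `⟨y, y⟩ = 1/κ` if
`κ > 0`, and the sheet `y₀ > 0` of the hyperboloid `⟨y, y⟩ = 1/κ` if `κ < 0`. -/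
def spaceForm (κ : ℝ) (d : ℕ) : Set (Fin (d + nu κ) → ℝ) :=
  {y | (κ ≠ 0 → semiForm (tau κ) (d + nu κ) y y = 1 / κ) ∧
    (κ < 0 → ∀ j : Fin (d + nu κ), j.val = 0 → 0 < y j)}

section Ambient

variable {l : ℕ} (k : Fin l → ℝ) (n : Fin l → ℕ)

/-- The ambient space `ℝ^N = ℝ^{N₁} × ⋯ × ℝ^{N_l}`, with `N_i = n_i + ν(k_i)`. -/
abbrev Ambient : Type := (i : Fin l) → Fin (n i + nu (k i)) → ℝ

/-- The product inner product on `ℝ^N`, in which the `i`-th factor has index `τ(k_i)`. -/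
def ambientForm : LinearMap.BilinForm ℝ (Ambient k n) :=
  ∑ i, (semiForm (tau (k i)) (n i + nu (k i))).compl₁₂ (LinearMap.proj i) (LinearMap.proj i)

/-- The product `Ô` of the space forms of dimension `n_i` and curvature `k_i`. -/
def productSpace : Set (Ambient k n) := {y | ∀ i, y i ∈ spaceForm (k i) (n i)}

/-- `π_i (x₁, …, x_l) = (0, …, x_i, …, 0)`. -/
def factorProj (i : Fin l) : Ambient k n →ₗ[ℝ] Ambient k n :=
  LinearMap.single ℝ (fun i : Fin l => Fin (n i + nu (k i)) → ℝ) i ∘ₗ LinearMap.proj i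

/-- The tangent space `T_y Ô = {w | ⟨w_i, y_i⟩ = 0 whenever k_i ≠ 0}` at a point `y` of `Ô`, the
kernel of the differential of the equations `⟨y_i, y_i⟩ = 1 / k_i` that define `Ô`. -/
def productTangent (y : Ambient k n) : Submodule ℝ (Ambient k n) where
  carrier := {w | ∀ i, k i ≠ 0 → semiForm (tau (k i)) (n i + nu (k i)) (w i) (y i) = 0}
  zero_mem' := fun i _ => by simp
  add_mem' := fun {a b} ha hb i hi => by simp [ha i hi, hb i hi]
  smul_mem' := fun c a ha i hi => by simp [ha i hi]

/-- For `y ∈ Ô`, the orthogonal projection `w ↦ (w_i - k_i ⟨w_i, y_i⟩ y_i)_i` of `ℝ^N` onto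
`T_y Ô`. -/
def productProj (y : Ambient k n) : Ambient k n →ₗ[ℝ] Ambient k n :=
  LinearMap.pi fun i => LinearMap.proj i -
    k i • ((semiForm (tau (k i)) (n i + nu (k i)) (y i)) ∘ₗ LinearMap.proj i).smulRight (y i)

end Ambient

/-! ### Vector fields and the Levi-Civita connection of a Riemannian manifold -/

section Riemannian

variable {m : ℕ} {M : Type*} [TopologicalSpace M] [ChartedSpace (EuclideanSpace ℝ (Fin m)) M]
  [IsManifold (𝓡 m) ∞ M]

/-- Smooth vector fields on `M`. -/
def IsSmoothField (X : (x : M) → TangentSpace (𝓡 m) x) : Prop :=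
  ContMDiff (𝓡 m) (𝓡 m).tangent ∞ fun x => (⟨x, X x⟩ : TangentBundle (𝓡 m) M)

variable [RiemannianBundle fun x : M => TangentSpace (𝓡 m) x]

/-- The right hand side of the Koszul formula for `2 ⟨∇_X Y, Z⟩`. -/
def koszul (X Y Z : (x : M) → TangentSpace (𝓡 m) x) (x : M) : ℝ :=
  mvfderiv (𝓡 m) (fun y : M => inner ℝ (Y y) (Z y)) x (X x)
    + mvfderiv (𝓡 m) (fun y : M => inner ℝ (X y) (Z y)) x (Y x)
    - mvfderiv (𝓡 m) (fun y : M => inner ℝ (X y) (Y y)) x (Z x)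
    + inner ℝ (VectorField.mlieBracket (𝓡 m) X Y x) (Z x)
    - inner ℝ (VectorField.mlieBracket (𝓡 m) X Z x) (Y x)
    - inner ℝ (VectorField.mlieBracket (𝓡 m) Y Z x) (X x)

/-- The Levi-Civita connection `∇_X Y` of the Riemannian manifold `M`, for smooth `X` and `Y`: its
value at `x` is the unique tangent vector `v` such that `2 ⟨v, Z⟩` is given at `x` by the Koszul
formula for all vector fields `Z` that are smooth at `x`. -/
def leviCivita (X Y : (x : M) → TangentSpace (𝓡 m) x) (x : M) : TangentSpace (𝓡 m) x :=
  Classical.epsilon fun v : TangentSpace (𝓡 m) x =>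
    ∀ Z : (y : M) → TangentSpace (𝓡 m) y,
      ContMDiffAt (𝓡 m) (𝓡 m).tangent ∞ (fun y => (⟨y, Z y⟩ : TangentBundle (𝓡 m) M)) x →
      2 * inner ℝ v (Z x) = koszul X Y Z x

end Riemannian

/-! ### Isometric immersions into the product -/

section Immersion

variable {l : ℕ} (k : Fin l → ℝ) (n : Fin l → ℕ)
variable (m : ℕ) {M : Type*} [TopologicalSpace M] [ChartedSpace (EuclideanSpace ℝ (Fin m)) M]
  [IsManifold (𝓡 m) ∞ M] [RiemannianBundle fun x : M => TangentSpace (𝓡 m) x]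
variable (f : M → Ambient k n)

/-- `f` is a smooth isometric immersion of the Riemannian manifold `M` into `Ô ⊂ ℝ^N`. -/
structure IsIsometricImmersion : Prop where
  smooth : ContMDiff (𝓡 m) 𝓘(ℝ, Ambient k n) ∞ f
  mem (x : M) : f x ∈ productSpace k n
  isometric (x : M) (u v : TangentSpace (𝓡 m) x) :
    ambientForm k n (mvfderiv (𝓡 m) f x u) (mvfderiv (𝓡 m) f x v) = inner ℝ u v

/-- The differential `f_* u`, as a vector of `ℝ^N`. -/
def push (x : M) (u : TangentSpace (𝓡 m) x) : Ambient k n := mvfderiv (𝓡 m) f x u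

instance (x : M) : FiniteDimensional ℝ (TangentSpace (𝓡 m) x) :=
  inferInstanceAs (FiniteDimensional ℝ (EuclideanSpace ℝ (Fin m)))

/-- An orthonormal basis of `T_x M`. -/
def tangentBasis (x : M) :
    OrthonormalBasis (Fin (Module.finrank ℝ (TangentSpace (𝓡 m) x))) ℝ (TangentSpace (𝓡 m) x) :=
  stdOrthonormalBasis ℝ (TangentSpace (𝓡 m) x)

/-- The normal space `T_x^⊥ M` of `f`: the orthogonal complement of `f_* T_x M` in `T_{f x} Ô`. -/
def normalSpace (x : M) : Submodule ℝ (Ambient k n) where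
  carrier := {w | w ∈ productTangent k n (f x) ∧
    ∀ u : TangentSpace (𝓡 m) x, ambientForm k n w (push k n m f x u) = 0}
  zero_mem' := ⟨Submodule.zero_mem _, fun u => by simp⟩
  add_mem' := fun {a b} ha hb => ⟨Submodule.add_mem _ ha.1 hb.1, fun u => by simp [ha.2, hb.2]⟩
  smul_mem' := fun c a ha => ⟨Submodule.smul_mem _ c ha.1, fun u => by simp [ha.2]⟩

/-- The normal component `w^⊥ = w - ∑_a ⟨w, f_* e_a⟩ f_* e_a` of a vector `w ∈ T_{f x} Ô`, where
`(e_a)` is an orthonormal basis of `T_x M`. -/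
def normalPart (x : M) : Ambient k n →ₗ[ℝ] Ambient k n :=
  LinearMap.id - ∑ a, (ambientForm k n (push k n m f x (tangentBasis m x a))).smulRight
    (push k n m f x (tangentBasis m x a))

/-- The derivative `∇̄_u W` at `x` of a field `W` along `f` tangent to `Ô`, for the Levi-Civita
connection of `Ô`: the component tangent to `Ô` of the derivative of `W` in `ℝ^N`. -/
def productConn (W : M → Ambient k n) (x : M) (u : TangentSpace (𝓡 m) x) : Ambient k n :=
  productProj k n (f x) (mvfderiv (𝓡 m) W x u)

/-- The second fundamental form `α(u, v) = (∇̄_u f_* V)^⊥`, where `V` is a local vector field, smooth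
near `x`, with `V x = v`. -/
def secondForm (x : M) (u v : TangentSpace (𝓡 m) x) : Ambient k n :=
  normalPart k n m f x (productConn k n m f (fun y => push k n m f y
    (FiberBundle.extend (EuclideanSpace ℝ (Fin m)) (E := fun y : M => TangentSpace (𝓡 m) y) v y))
    x u)

/-- The mean curvature vector `η = (1/m) tr α`. -/
def meanCurvature (x : M) : Ambient k n :=
  (1 / (m : ℝ)) • ∑ a, secondForm k n m f x (tangentBasis m x a) (tangentBasis m x a)

/-- The first normal space `N₁(x)`, spanned by the values of `α`. -/
def firstNormal (x : M) : Submodule ℝ (Ambient k n) :=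
  Submodule.span ℝ {w | ∃ u v : TangentSpace (𝓡 m) x, w = secondForm k n m f x u v}

/-- The orthogonal complement `N₁(x)^⊥` of the first normal space in `T_x^⊥ M`. -/
def firstNormalPerp (x : M) : Submodule ℝ (Ambient k n) where
  carrier := {w | w ∈ normalSpace k n m f x ∧ ∀ z ∈ firstNormal k n m f x, ambientForm k n w z = 0}
  zero_mem' := ⟨Submodule.zero_mem _, fun u _ => by simp⟩
  add_mem' := fun {a b} ha hb =>
    ⟨Submodule.add_mem _ ha.1 hb.1, fun u hu => by simp [ha.2 u hu, hb.2 u hu]⟩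
  smul_mem' := fun c a ha => ⟨Submodule.smul_mem _ c ha.1, fun u hu => by simp [ha.2 u hu]⟩

/-- The tensor `T_i = K_i^† K_i` on `T_x^⊥ M`, where `K_i = π_i|_{T^⊥ M}`; since `K_i^† w = (π_i w)^⊥`
for `w ∈ T_{f x} Ô`, one has `T_i ξ = (π_i ξ)^⊥`. -/
def tensorT (i : Fin l) (x : M) : Ambient k n →ₗ[ℝ] Ambient k n :=
  normalPart k n m f x ∘ₗ factorProj k n i

/-- `V_i(x) = ker (Id - T_i) ⊂ T_x^⊥ M`. -/
def eigenOne (i : Fin l) (x : M) : Submodule ℝ (Ambient k n) :=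
  normalSpace k n m f x ⊓ LinearMap.ker (LinearMap.id - tensorT k n m f i x)

/-- The fibre `V_i(x) ∩ N₁(x)^⊥`. -/
def eigenPerp (i : Fin l) (x : M) : Submodule ℝ (Ambient k n) :=
  eigenOne k n m f i x ⊓ firstNormalPerp k n m f x

/-- The normal connection `∇^⊥_u ξ = (∇̄_u ξ)^⊥` at `x`, for `u ∈ T_x M`. -/
def normalConn (ξ : M → Ambient k n) (x : M) (u : TangentSpace (𝓡 m) x) : Ambient k n :=
  normalPart k n m f x (productConn k n m f ξ x u)

/-- The normal section `∇^⊥_X ξ`. -/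
def normalDeriv (X : (x : M) → TangentSpace (𝓡 m) x) (ξ : M → Ambient k n) : M → Ambient k n :=
  fun x => normalConn k n m f ξ x (X x)

/-- The normal curvature `R^⊥(X, Y) ξ = ∇^⊥_X ∇^⊥_Y ξ - ∇^⊥_Y ∇^⊥_X ξ - ∇^⊥_{[X, Y]} ξ`. -/
def normalCurv (X Y : (x : M) → TangentSpace (𝓡 m) x) (ξ : M → Ambient k n) : M → Ambient k n :=
  normalDeriv k n m f X (normalDeriv k n m f Y ξ) - normalDeriv k n m f Y (normalDeriv k n m f X ξ)
    - normalDeriv k n m f (VectorField.mlieBracket (𝓡 m) X Y) ξ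

/-- `(∇^⊥_Z R^⊥)(X, Y, ξ) = ∇^⊥_Z (R^⊥(X, Y) ξ) - R^⊥(∇_Z X, Y) ξ - R^⊥(X, ∇_Z Y) ξ
- R^⊥(X, Y) ∇^⊥_Z ξ`. -/
def normalCurvDeriv (Z X Y : (x : M) → TangentSpace (𝓡 m) x) (ξ : M → Ambient k n) :
    M → Ambient k n :=
  normalDeriv k n m f Z (normalCurv k n m f X Y ξ) - normalCurv k n m f (leviCivita Z X) Y ξ
    - normalCurv k n m f X (leviCivita Z Y) ξ - normalCurv k n m f X Y (normalDeriv k n m f Z ξ)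

end Immersion

/-! ### Bundles of subspaces -/

section Subbundle

variable (m : ℕ) {M : Type*} [TopologicalSpace M] [ChartedSpace (EuclideanSpace ℝ (Fin m)) M]
  {E : Type*} [NormedAddCommGroup E] [NormedSpace ℝ E]

/-- The subspaces `L x` of `E` form a smooth vector subbundle (of the trivial bundle `M × E`, hence
of any subbundle of it that contains them): near every point they have a smooth frame. -/
def IsSubbundle (L : M → Submodule ℝ E) : Prop :=
  ∀ x₀ : M, ∃ U : Set M, IsOpen U ∧ x₀ ∈ U ∧ ∃ (r : ℕ) (s : Fin r → M → E),
    (∀ j, ContMDiffOn (𝓡 m) 𝓘(ℝ, E) ∞ (s j) U) ∧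
    ∀ x ∈ U, LinearIndependent ℝ (fun j => s j x) ∧
      Submodule.span ℝ (Set.range fun j => s j x) = L x

/-- `ξ` is a smooth section of the bundle with fibres `L x ⊂ E`. -/
def IsSmoothSection (L : M → Submodule ℝ E) (ξ : M → E) : Prop :=
  ContMDiff (𝓡 m) 𝓘(ℝ, E) ∞ ξ ∧ ∀ x, ξ x ∈ L x

end Subbundle

end SpaceFormProduct

end

set_option linter.unusedSectionVars false

namespace SpaceFormProduct

/-! ### Directional derivatives of vector-valued functions -/

section DirectionalDerivative

open VectorField Filter Topology Set

variable {m : ℕ} {M : Type*} [TopologicalSpace M] [ChartedSpace (EuclideanSpace ℝ (Fin m)) M]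
  {F : Type*} [NormedAddCommGroup F] [NormedSpace ℝ F]

/-! Everything is computed with the flat derivative `D` of $\mathbb R^N$. If $\mathbf T_i\xi=\xi$,
then $\langle\xi,\pi_i\xi\rangle=\langle\xi,\xi\rangle$; as the metric of $\hat{\mathbb O}$ is
positive definite, $\pi_i\xi=\xi$ (`factorProj_eq_self_of_mem_eigenOne`). Hence $\xi$ and $D\xi$
live in the $i$-th factor, and $D\xi$ is already tangent to $\hat{\mathbb O}$
(`IsFactorField.mvfderiv_mem`). If moreover $\xi\perp\mathcal N_1$, its shape operator vanishes, so
$\nabla^\perp\xi=D\xi$. Flatness of $D$ gives $\mathcal R^\perp(X,Y)\xi=0$, and therefore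
$(\nabla^\perp_Z\mathcal R^\perp)(X,Y,\xi)=-\mathcal R^\perp(X,Y)D_Z\xi$ (`normalCurvDeriv_eq`).

If $\nabla^\perp\xi$ stays in $\mathcal N_1^\perp$, then $D_Z\xi$ is again a section of $\mathcal
V_i\cap\mathcal N_1^\perp$, which gives (I); (II) holds because $\eta\in\mathcal N_1$.

Conversely, let $B(z,y)=A_{D_z\xi}\,y$, with $A$ the shape operator. A Codazzi argument makes
$\langle B(z,y),u\rangle=\langle D_z\xi,\alpha(u,y)\rangle$ symmetric in all three arguments. By (I)
and the Ricci equation `IsFactorField.normalCurv_eq`, the operators $B(z,\cdot)$ commute. Then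
$\sum_a|B(u,e_a)|^2=\sum_a\langle B(e_a,e_a),B(u,u)\rangle=\langle D_{B(u,u)}\xi,\,m\eta\rangle$,
which is zero by (II). So $B=0$, that is, $D\xi\perp\mathcal N_1$. -/

/-- The vector field `X` is smooth at `x`. -/
def IsSmoothFieldAt [IsManifold (𝓡 m) ∞ M] (X : (x : M) → TangentSpace (𝓡 m) x) (x : M) : Prop :=
  ContMDiffAt (𝓡 m) (𝓡 m).tangent ∞ (fun y => (⟨y, X y⟩ : TangentBundle (𝓡 m) M)) x

/-- The derivative `D_X g` of a vector-valued function along a vector field. -/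
noncomputable def dirDeriv (X : (x : M) → TangentSpace (𝓡 m) x) (g : M → F) : M → F :=
  fun y => mvfderiv (𝓡 m) g y (X y)

lemma dirDeriv_apply (X : (x : M) → TangentSpace (𝓡 m) x) (g : M → F) (x : M) :
    dirDeriv X g x = mvfderiv (𝓡 m) g x (X x) := rfl

section Linear

variable {F' : Type*} [NormedAddCommGroup F'] [NormedSpace ℝ F'] {x : M}

lemma mvfderiv_congr {g g' : M → F} (h : g =ᶠ[𝓝 x] g') :
    mvfderiv (𝓡 m) g x = mvfderiv (𝓡 m) g' x := by
  ext u
  have h1 := h.mfderiv_eq (I := 𝓡 m) (I' := 𝓘(ℝ, F))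
  have : (mfderiv (𝓡 m) 𝓘(ℝ, F) g x) u = (mfderiv (𝓡 m) 𝓘(ℝ, F) g' x) u := by
    rw [h1]; rfl
  exact this

lemma mvfderiv_clm_comp (L : F →L[ℝ] F') {g : M → F} (hg : MDifferentiableAt (𝓡 m) 𝓘(ℝ, F) g x)
    (u : TangentSpace (𝓡 m) x) :
    mvfderiv (𝓡 m) (fun y => L (g y)) x u = L (mvfderiv (𝓡 m) g x u) := by
  have h := mfderiv_comp_apply (I := 𝓡 m) (I' := 𝓘(ℝ, F)) (I'' := 𝓘(ℝ, F')) x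
    (g := L) (f := g) L.differentiableAt.mdifferentiableAt hg u
  rw [mfderiv_eq_fderiv, L.fderiv] at h
  exact h

lemma mvfderiv_bilin (B : F →L[ℝ] F →L[ℝ] F') {a b : M → F}
    (ha : MDifferentiableAt (𝓡 m) 𝓘(ℝ, F) a x) (hb : MDifferentiableAt (𝓡 m) 𝓘(ℝ, F) b x)
    (u : TangentSpace (𝓡 m) x) :
    mvfderiv (𝓡 m) (fun y => B (a y) (b y)) x u =
      B (mvfderiv (𝓡 m) a x u) (b x) + B (a x) (mvfderiv (𝓡 m) b x u) := by
  have hab : MDifferentiableAt (𝓡 m) 𝓘(ℝ, F × F) (fun y => (a y, b y)) x := ha.prodMk_space hb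
  have hB := B.isBoundedBilinearMap
  have h := mfderiv_comp_apply (I := 𝓡 m) (I' := 𝓘(ℝ, F × F)) (I'' := 𝓘(ℝ, F')) x
    (g := fun p : F × F => B p.1 p.2) (f := fun y => (a y, b y))
    (hB.differentiableAt _).mdifferentiableAt hab u
  rw [mfderiv_eq_fderiv, hB.fderiv] at h
  have h1 := mvfderiv_clm_comp (ContinuousLinearMap.fst ℝ F F) hab u
  have h2 := mvfderiv_clm_comp (ContinuousLinearMap.snd ℝ F F) hab u
  refine h.trans ?_
  simp only [ContinuousLinearMap.coe_fst', ContinuousLinearMap.coe_snd'] at h1 h2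
  rw [h1, h2, add_comm]
  rfl

end Linear

variable [IsManifold (𝓡 m) ∞ M]

lemma contMDiffAt_dirDeriv {X : (x : M) → TangentSpace (𝓡 m) x} {x : M} (hX : IsSmoothFieldAt X x)
    {g : M → F} (hg : ContMDiff (𝓡 m) 𝓘(ℝ, F) ∞ g) :
    ContMDiffAt (𝓡 m) 𝓘(ℝ, F) ∞ (dirDeriv X g) x := by
  have h := (hg.contMDiff_tangentMap (m := ∞) le_rfl).contMDiffAt.comp x hX
  exact (contMDiff_snd_tangentBundle_modelSpace F 𝓘(ℝ, F)).contMDiffAt.comp x h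

/-- The chain rule: pulling the field back by the inverse chart cancels the differential of the
chart. It transfers directional derivatives to Euclidean space. -/
lemma fderiv_comp_extChartAt_symm {X : (x : M) → TangentSpace (𝓡 m) x} {g : M → F} (x : M)
    {e : EuclideanSpace ℝ (Fin m)} (he : e ∈ (extChartAt (𝓡 m) x).target)
    (hg : MDifferentiableAt (𝓡 m) 𝓘(ℝ, F) g ((extChartAt (𝓡 m) x).symm e)) :
    fderiv ℝ (g ∘ (extChartAt (𝓡 m) x).symm) e
      (mpullbackWithin 𝓘(ℝ, EuclideanSpace ℝ (Fin m)) (𝓡 m) (extChartAt (𝓡 m) x).symm X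
        (range (𝓡 m)) e) = dirDeriv X g ((extChartAt (𝓡 m) x).symm e) := by
  have hinv := isInvertible_mfderivWithin_extChartAt_symm (I := 𝓡 m) he
  have hd : MDifferentiableWithinAt 𝓘(ℝ, EuclideanSpace ℝ (Fin m)) (𝓡 m)
      (extChartAt (𝓡 m) x).symm (range (𝓡 m)) e :=
    mdifferentiableWithinAt_extChartAt_symm he
  have h := mfderiv_comp_mfderivWithin (I := 𝓘(ℝ, EuclideanSpace ℝ (Fin m))) (I' := 𝓡 m)
    (I'' := 𝓘(ℝ, F)) e hg hd ((𝓡 m).uniqueMDiffOn _ (extChartAt_target_subset_range x he))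
  rw [mpullbackWithin_apply]
  have hr : range (𝓡 m) = univ := (𝓡 m).range_eq_univ
  rw [← mfderiv_eq_fderiv, ← mfderivWithin_univ, ← hr, h]
  obtain ⟨A, hA⟩ := hinv
  rw [← hA, ContinuousLinearMap.inverse_equiv]
  exact congrArg (mfderiv (𝓡 m) 𝓘(ℝ, F) g ((extChartAt (𝓡 m) x).symm e))
    (A.apply_symm_apply (X ((extChartAt (𝓡 m) x).symm e)))

/-- In a chart the second derivative of `g` is symmetric, so only the derivatives of the fields
survive. For `g = f` this is absence of torsion; for a normal field it is flatness of `D`. -/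
lemma dirDeriv_mlieBracket {X Y : (x : M) → TangentSpace (𝓡 m) x} {x : M}
    (hX : IsSmoothFieldAt X x) (hY : IsSmoothFieldAt Y x)
    {g : M → F} (hg : ContMDiff (𝓡 m) 𝓘(ℝ, F) ∞ g) :
    dirDeriv X (dirDeriv Y g) x - dirDeriv Y (dirDeriv X g) x =
      dirDeriv (mlieBracket (𝓡 m) X Y) g x := by
  set φ := extChartAt (𝓡 m) x
  let X' : EuclideanSpace ℝ (Fin m) → EuclideanSpace ℝ (Fin m) :=
    mpullbackWithin 𝓘(ℝ, EuclideanSpace ℝ (Fin m)) (𝓡 m) φ.symm X (range (𝓡 m))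
  let Y' : EuclideanSpace ℝ (Fin m) → EuclideanSpace ℝ (Fin m) :=
    mpullbackWithin 𝓘(ℝ, EuclideanSpace ℝ (Fin m)) (𝓡 m) φ.symm Y (range (𝓡 m))
  let G : EuclideanSpace ℝ (Fin m) → F := g ∘ φ.symm
  have hr : range (𝓡 m) = univ := (𝓡 m).range_eq_univ
  have hG : ContDiffAt ℝ ∞ G (φ x) := by
    have h := (contMDiffOn_extChartAt_symm (I := 𝓡 m) (n := ∞) x).contMDiffAt
      (extChartAt_target_mem_nhds (I := 𝓡 m) x)
    exact (hg.contMDiffAt.comp _ h).contDiffAt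
  have hdiff : ∀ X : (x : M) → TangentSpace (𝓡 m) x, IsSmoothFieldAt X x →
      DifferentiableAt ℝ (mpullbackWithin 𝓘(ℝ, EuclideanSpace ℝ (Fin m)) (𝓡 m) φ.symm X
        (range (𝓡 m))) (φ x) := by
    intro X hX
    have h := (hX.mdifferentiableAt (by simp)).mdifferentiableWithinAt (s := univ)
    have h1 := h.differentiableWithinAt_mpullbackWithin_vectorField
    have hs : φ.symm ⁻¹' univ ∩ range (𝓡 m) = univ := by rw [hr, preimage_univ, univ_inter]
    exact differentiableWithinAt_univ.1 (h1.mono hs.ge)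
  have key : ∀ X Y : (x : M) → TangentSpace (𝓡 m) x, IsSmoothFieldAt Y x →
      dirDeriv X (dirDeriv Y g) x =
        fderiv ℝ (fun e => fderiv ℝ G e
          (mpullbackWithin 𝓘(ℝ, EuclideanSpace ℝ (Fin m)) (𝓡 m) φ.symm Y (range (𝓡 m)) e)) (φ x)
          (mpullbackWithin 𝓘(ℝ, EuclideanSpace ℝ (Fin m)) (𝓡 m) φ.symm X (range (𝓡 m))
            (φ x)) := by
    intro X Y hY
    have h1 := fderiv_comp_extChartAt_symm (X := X) (g := dirDeriv Y g) x
      (mem_extChartAt_target (I := 𝓡 m) x) (by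
        rw [extChartAt_to_inv]; exact (contMDiffAt_dirDeriv hY hg).mdifferentiableAt (by simp))
    rw [extChartAt_to_inv] at h1
    rw [← h1]
    have h2 : (dirDeriv Y g ∘ φ.symm) =ᶠ[𝓝 (φ x)] fun e => fderiv ℝ G e
          (mpullbackWithin 𝓘(ℝ, EuclideanSpace ℝ (Fin m)) (𝓡 m) φ.symm Y (range (𝓡 m)) e) := by
      filter_upwards [extChartAt_target_mem_nhds (I := 𝓡 m) x] with e he
      exact (fderiv_comp_extChartAt_symm x he (hg.mdifferentiable (by simp) _)).symm
    rw [← h2.fderiv_eq]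
  have hbr : dirDeriv (mlieBracket (𝓡 m) X Y) g x =
      fderiv ℝ G (φ x) (lieBracket ℝ X' Y' (φ x)) := by
    have hs : φ.symm ⁻¹' univ ∩ range (𝓡 m) = univ := by rw [hr, preimage_univ, univ_inter]
    have h2 : mlieBracket (𝓡 m) X Y x =
        (mfderiv (𝓡 m) 𝓘(ℝ, EuclideanSpace ℝ (Fin m)) φ x).inverse
          (lieBracket ℝ X' Y' (φ x)) := by
      have h3 : lieBracketWithin ℝ X' Y' (φ.symm ⁻¹' univ ∩ range (𝓡 m)) =
          lieBracket ℝ X' Y' := by rw [hs, lieBracketWithin_univ]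
      exact congrArg (fun Z : EuclideanSpace ℝ (Fin m) → EuclideanSpace ℝ (Fin m) =>
        (mfderiv (𝓡 m) 𝓘(ℝ, EuclideanSpace ℝ (Fin m)) φ x).inverse (Z (φ x))) h3
    obtain ⟨A, hA⟩ := isInvertible_mfderiv_extChartAt (I := 𝓡 m)
      (mem_extChartAt_source (I := 𝓡 m) x)
    rw [← hA, ContinuousLinearMap.inverse_equiv] at h2
    have h4 : g =ᶠ[𝓝 x] G ∘ φ := by
      filter_upwards [extChartAt_source_mem_nhds (I := 𝓡 m) x] with y hy
      exact congrArg g (φ.left_inv hy).symm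
    have h5 := mfderiv_comp_apply (I := 𝓡 m) (I' := 𝓘(ℝ, EuclideanSpace ℝ (Fin m)))
      (I'' := 𝓘(ℝ, F)) x (g := G) (f := φ) (hG.differentiableAt (by simp)).mdifferentiableAt
      (mdifferentiableAt_extChartAt (mem_chart_source _ x)) (mlieBracket (𝓡 m) X Y x)
    rw [mfderiv_eq_fderiv] at h5
    rw [dirDeriv_apply, mvfderiv_congr h4]
    refine Eq.trans h5 (congrArg (fderiv ℝ G (φ x)) ?_)
    rw [h2, ← hA]
    exact A.apply_symm_apply _
  have h2 : (2 : WithTop ℕ∞) ≤ ∞ := WithTop.coe_le_coe.2 le_top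
  rw [hbr, key X Y hY, key Y X hX]
  exact (fderiv_apply_lieBracket_of_isSymmSndFDerivAt (hG.of_le h2)
    (hG.isSymmSndFDerivAt (by rwa [minSmoothness_of_isRCLikeNormedField]))
    (hdiff Y hY) (hdiff X hX)).symm

end DirectionalDerivative

/-! ### Constructions of smooth vector fields -/

section SmoothFields

open Filter Topology Set

variable {m : ℕ} {M : Type*} [TopologicalSpace M] [ChartedSpace (EuclideanSpace ℝ (Fin m)) M]
  [IsManifold (𝓡 m) ∞ M]

lemma IsSmoothField.at {X : (x : M) → TangentSpace (𝓡 m) x} (hX : IsSmoothField X) (x : M) :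
    IsSmoothFieldAt X x :=
  hX.contMDiffAt

lemma isSmoothFieldAt_extend {x : M} (u : TangentSpace (𝓡 m) x) :
    IsSmoothFieldAt (FiberBundle.extend (EuclideanSpace ℝ (Fin m))
      (E := fun y : M => TangentSpace (𝓡 m) y) u) x :=
  FiberBundle.contMDiffAt_extend (𝓡 m) (EuclideanSpace ℝ (Fin m)) u

/-- A local extension is cut off by a bump function. Condition (I) only speaks of global fields, so
pointwise identities are drawn from it this way. -/
lemma exists_isSmoothField_apply_eq [T2Space M] {x : M} (u : TangentSpace (𝓡 m) x) :
    ∃ X : (y : M) → TangentSpace (𝓡 m) y, IsSmoothField X ∧ X x = u := by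
  obtain ⟨s, hs, hsm⟩ := FiberBundle.exists_contMDiffOn_extend (𝓡 m)
    (EuclideanSpace ℝ (Fin m)) (k := ∞) u
  obtain ⟨t, hts, ht, hxt⟩ := mem_nhds_iff.1 hs
  obtain ⟨ρ, -, hρ⟩ := (SmoothBumpFunction.nhds_basis_tsupport (I := 𝓡 m) x).mem_iff.1
    (ht.mem_nhds hxt)
  refine ⟨_, ContMDiffOn.smul_section_of_tsupport ρ.contMDiff.contMDiffOn ht hρ (hsm.mono hts), ?_⟩
  simp

/-- In a local frame, the coordinates of `V` solve a linear system whose matrix is the Gram matrix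
of the frame; inversion of operators is smooth. -/
lemma isSmoothFieldAt_of_inner [RiemannianBundle fun x : M => TangentSpace (𝓡 m) x]
    [IsContMDiffRiemannianBundle (𝓡 m) ∞ (EuclideanSpace ℝ (Fin m))
      fun x : M => TangentSpace (𝓡 m) x]
    {V : (x : M) → TangentSpace (𝓡 m) x} {x : M}
    (h : ∀ Y : (x : M) → TangentSpace (𝓡 m) x, IsSmoothFieldAt Y x →
      ContMDiffAt (𝓡 m) 𝓘(ℝ, ℝ) ∞ (fun y => inner ℝ (V y) (Y y)) x) :
    IsSmoothFieldAt V x := by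
  let e := trivializationAt (EuclideanSpace ℝ (Fin m)) (fun y : M => TangentSpace (𝓡 m) y) x
  let b := EuclideanSpace.basisFun (Fin m) ℝ
  let s : Fin m → (y : M) → TangentSpace (𝓡 m) y := fun j y => e.symmL ℝ y (b j)
  have hx : x ∈ e.baseSet := FiberBundle.mem_baseSet_trivializationAt' x
  have hs : ∀ j, IsSmoothFieldAt (s j) x := by
    intro j
    refine (contMDiffAt_section (IB := 𝓡 m) (E := fun y : M => TangentSpace (𝓡 m) y)
      (s := s j) x).2 ?_
    refine (contMDiffAt_const (c := b j)).congr_of_eventuallyEq ?_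
    filter_upwards [e.open_baseSet.mem_nhds hx] with y hy
    change (e ⟨y, e.symmL ℝ y (b j)⟩).2 = b j
    rw [e.symmL_apply hy, e.apply_mk_symm hy]
  let G : M → EuclideanSpace ℝ (Fin m) →L[ℝ] EuclideanSpace ℝ (Fin m) := fun y =>
    ∑ a, ∑ j, (inner ℝ (s a y) (s j y) : ℝ) • (innerSL ℝ (b a)).smulRight (b j)
  have hG : ContMDiffAt (𝓡 m) 𝓘(ℝ, EuclideanSpace ℝ (Fin m) →L[ℝ] EuclideanSpace ℝ (Fin m)) ∞
      G x := by
    refine ContMDiffAt.sum fun a _ => ContMDiffAt.sum fun j _ => ?_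
    exact ((hs a).inner_bundle (hs j)).smul contMDiffAt_const
  let w : M → EuclideanSpace ℝ (Fin m) := fun y => ∑ j, (inner ℝ (V y) (s j y) : ℝ) • b j
  have hw : ContMDiffAt (𝓡 m) 𝓘(ℝ, EuclideanSpace ℝ (Fin m)) ∞ w x :=
    ContMDiffAt.sum fun j _ => (h _ (hs j)).smul contMDiffAt_const
  have hsum : ∀ y ∈ e.baseSet, ∀ c : EuclideanSpace ℝ (Fin m),
      e.symmL ℝ y c = ∑ a, c a • s a y := by
    intro y hy c
    have hc : c = ∑ a, c a • b a := by
      conv_lhs => rw [← b.sum_repr c]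
      rfl
    have h1 := congrArg (e.symmL ℝ y) hc
    rw [map_sum] at h1
    simp only [map_smul] at h1
    exact h1
  have hGw : ∀ y ∈ e.baseSet, ∀ c : EuclideanSpace ℝ (Fin m),
      G y c = ∑ j, (inner ℝ (e.symmL ℝ y c) (s j y) : ℝ) • b j := by
    intro y hy c
    simp only [G, sum_apply, smul_apply,
      ContinuousLinearMap.smulRight_apply, innerSL_apply_apply]
    rw [Finset.sum_comm]
    refine Finset.sum_congr rfl fun j _ => ?_
    rw [hsum y hy c, sum_inner, Finset.sum_smul]
    refine Finset.sum_congr rfl fun a _ => ?_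
    rw [smul_smul, inner_smul_left, EuclideanSpace.basisFun_inner, mul_comm]
    rfl
  -- $\langle Gc,c\rangle$ is the squared length of $\sum_a c_as_a$.
  have hinj : ∀ y ∈ e.baseSet, Function.Injective (G y) := by
    intro y hy
    rw [injective_iff_map_eq_zero]
    intro c hc
    have h1 : inner ℝ (e.symmL ℝ y c) (e.symmL ℝ y c) = (0 : ℝ) := by
      have h2 : inner ℝ (G y c) c = (0 : ℝ) := by rw [hc, inner_zero_left]
      rw [hGw y hy c, sum_inner] at h2
      rw [← h2]
      conv_lhs => rw [hsum y hy c, inner_sum, ← hsum y hy c]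
      refine Finset.sum_congr rfl fun j _ => ?_
      rw [inner_smul_left, inner_smul_right, EuclideanSpace.basisFun_inner, mul_comm]
      rfl
    have h2 := inner_self_eq_zero.1 h1
    have h3 := e.continuousLinearMapAt_symmL (R := ℝ) hy c
    rw [← h3, h2, map_zero]
  have hinv : ∀ y ∈ e.baseSet, ∃ A : EuclideanSpace ℝ (Fin m) ≃L[ℝ] EuclideanSpace ℝ (Fin m),
      (A : EuclideanSpace ℝ (Fin m) →L[ℝ] EuclideanSpace ℝ (Fin m)) = G y := by
    intro y hy
    refine ⟨(LinearEquiv.ofInjectiveEndo (G y : EuclideanSpace ℝ (Fin m) →ₗ[ℝ] _)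
      (hinj y hy)).toContinuousLinearEquiv, ?_⟩
    ext c
    rfl
  refine (contMDiffAt_section (IB := 𝓡 m) (E := fun y : M => TangentSpace (𝓡 m) y)
    (s := V) x).2 ?_
  obtain ⟨A, hA⟩ := hinv x hx
  have h1 : ContMDiffAt (𝓡 m) 𝓘(ℝ, EuclideanSpace ℝ (Fin m)) ∞
      (fun y => (G y).inverse (w y)) x := by
    have h2 : ContMDiffAt (𝓡 m) 𝓘(ℝ, EuclideanSpace ℝ (Fin m) →L[ℝ] EuclideanSpace ℝ (Fin m)) ∞
        (fun y => (G y).inverse) x := by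
      have h3 := contDiffAt_map_inverse (n := ∞) A
      rw [hA] at h3
      exact h3.contMDiffAt.comp x hG
    exact h2.clm_apply hw
  refine h1.congr_of_eventuallyEq ?_
  filter_upwards [e.open_baseSet.mem_nhds hx] with y hy
  obtain ⟨A, hA⟩ := hinv y hy
  have h2 := hGw y hy (e ⟨y, V y⟩).2
  rw [e.symmL_apply hy, e.symm_apply_apply_mk hy] at h2
  change (e ⟨y, V y⟩).2 = _
  have h3 : w y = A (e ⟨y, V y⟩).2 := by
    rw [← ContinuousLinearEquiv.coe_coe, hA, h2]
  rw [h3, ← hA, ContinuousLinearMap.inverse_equiv]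
  simp

end SmoothFields
/-! ### The inner product of the ambient space -/

section Forms

lemma semiForm_apply (t N : ℕ) (x y : Fin N → ℝ) :
    semiForm t N x y = ∑ j, (if j.val < t then (-1 : ℝ) else 1) * (x j * y j) := rfl

lemma semiForm_comm (t N : ℕ) (x y : Fin N → ℝ) : semiForm t N x y = semiForm t N y x := by
  simp only [semiForm_apply, mul_comm (x _)]

lemma semiForm_zero_self_nonneg (N : ℕ) (x : Fin N → ℝ) : 0 ≤ semiForm 0 N x x := by
  rw [semiForm_apply]
  exact Finset.sum_nonneg fun j _ => by simpa using mul_self_nonneg (x j)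

lemma eq_zero_of_semiForm_zero_self {N : ℕ} {x : Fin N → ℝ} (h : semiForm 0 N x x = 0) :
    x = 0 := by
  rw [semiForm_apply, Finset.sum_eq_zero_iff_of_nonneg
    fun j _ => by simpa using mul_self_nonneg (x j)] at h
  ext j
  simpa using h j (Finset.mem_univ j)

lemma semiForm_one_succ (d : ℕ) (x y : Fin (d + 1) → ℝ) :
    semiForm 1 (d + 1) x y = -(x 0 * y 0) + ∑ j : Fin d, x j.succ * y j.succ := by
  simp [semiForm_apply, Fin.sum_univ_succ]

/-- The orthogonal complement of a timelike vector is spacelike. Orthogonality makes the spatial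
product equal to $w_0y_0$, and Cauchy–Schwarz gives $w_0^2y_0^2\le WY$ with $Y<y_0^2$. -/
lemma semiForm_one_self_of_orthogonal {d : ℕ} {w y : Fin (d + 1) → ℝ}
    (hy : semiForm 1 (d + 1) y y < 0) (hwy : semiForm 1 (d + 1) w y = 0) :
    0 ≤ semiForm 1 (d + 1) w w ∧ (semiForm 1 (d + 1) w w = 0 → w = 0) := by
  rw [semiForm_one_succ] at hy hwy
  rw [semiForm_one_succ]
  have hcs := Finset.sum_mul_sq_le_sq_mul_sq Finset.univ (fun j : Fin d => w j.succ)
    (fun j => y j.succ)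
  set P := ∑ j : Fin d, w j.succ * y j.succ
  have hW : ∑ j : Fin d, w j.succ ^ 2 = ∑ j : Fin d, w j.succ * w j.succ := by simp only [sq]
  have hY : ∑ j : Fin d, y j.succ ^ 2 = ∑ j : Fin d, y j.succ * y j.succ := by simp only [sq]
  rw [hW, hY] at hcs
  set W := ∑ j : Fin d, w j.succ * w j.succ with hWdef
  set Y := ∑ j : Fin d, y j.succ * y j.succ
  have hW0 : 0 ≤ W := Finset.sum_nonneg fun j _ => mul_self_nonneg _
  have hY0 : 0 ≤ Y := Finset.sum_nonneg fun j _ => mul_self_nonneg _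
  have hP : P = w 0 * y 0 := by linarith
  have hy0 : 0 < y 0 * y 0 := by linarith
  have h1 : (w 0 * w 0) * (y 0 * y 0) ≤ W * Y := by rw [hP] at hcs; linarith
  have h2 : 0 ≤ W * (y 0 * y 0 - Y) := mul_nonneg hW0 (by linarith)
  refine ⟨?_, fun h => ?_⟩
  · have : 0 ≤ (W - w 0 * w 0) * (y 0 * y 0) := by linarith
    have := nonneg_of_mul_nonneg_left this hy0
    linarith
  · have h3 : W = w 0 * w 0 := by linarith
    have h4 : W * (y 0 * y 0 - Y) = 0 := by
      rw [← h3] at h1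
      linarith
    have h5 : W = 0 := (mul_eq_zero.1 h4).resolve_right (by linarith)
    have h6 := (Finset.sum_eq_zero_iff_of_nonneg (fun j _ => mul_self_nonneg (w j.succ))).1 h5
    ext j
    refine Fin.cases ?_ (fun j => ?_) j
    · simpa using h3.symm.trans h5
    · simpa using h6 j (Finset.mem_univ j)

lemma semiForm_self_of_tangent {κ : ℝ} {d : ℕ} {w y : Fin (d + nu κ) → ℝ}
    (hy : y ∈ spaceForm κ d) (hw : κ ≠ 0 → semiForm (tau κ) (d + nu κ) w y = 0) :
    0 ≤ semiForm (tau κ) (d + nu κ) w w ∧ (semiForm (tau κ) (d + nu κ) w w = 0 → w = 0) := by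
  by_cases hκ : κ < 0
  · have hn : nu κ = 1 := if_neg hκ.ne
    have ht : tau κ = 1 := if_pos hκ
    have hy1 := hy.1 hκ.ne
    have hw1 := hw hκ.ne
    have hneg : 1 / κ < 0 := one_div_neg.2 hκ
    -- The types of `w` and `y` depend on `nu κ`, so both are generalized before it is rewritten.
    clear hy hw
    revert w y
    rw [hn, ht]
    intro w y hy hw
    exact semiForm_one_self_of_orthogonal (hy.trans_lt hneg) hw
  · have ht : tau κ = 0 := if_neg hκ
    rw [ht]
    exact ⟨semiForm_zero_self_nonneg _ w, eq_zero_of_semiForm_zero_self⟩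

variable {l : ℕ} {k : Fin l → ℝ} {n : Fin l → ℕ}

lemma ambientForm_apply (w z : Ambient k n) :
    ambientForm k n w z = ∑ i, semiForm (tau (k i)) (n i + nu (k i)) (w i) (z i) := by
  simp [ambientForm, LinearMap.sum_apply]

lemma ambientForm_comm (w z : Ambient k n) : ambientForm k n w z = ambientForm k n z w := by
  simp only [ambientForm_apply, semiForm_comm _ _ (w _)]

variable (k n) in
/-- The inner product of the ambient space as a continuous bilinear map. -/
noncomputable def ambientFormL : Ambient k n →L[ℝ] Ambient k n →L[ℝ] ℝ :=
  LinearMap.toContinuousLinearMap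
    ((LinearMap.toContinuousLinearMap : (Ambient k n →ₗ[ℝ] ℝ) ≃ₗ[ℝ] _).toLinearMap ∘ₗ
      ambientForm k n)

/-! ### Projections onto a factor and onto the tangent space of the product -/

lemma factorProj_apply_same (i : Fin l) (w : Ambient k n) : factorProj k n i w i = w i := by
  simp [factorProj]

lemma factorProj_apply_ne {i j : Fin l} (h : j ≠ i) (w : Ambient k n) :
    factorProj k n i w j = 0 := by
  simp [factorProj, h]

lemma factorProj_eq_self_iff {i : Fin l} {w : Ambient k n} :
    factorProj k n i w = w ↔ ∀ j, j ≠ i → w j = 0 := by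
  refine ⟨fun h j hj => ?_, fun h => ?_⟩
  · rw [← h, factorProj_apply_ne hj]
  · funext j
    by_cases hj : j = i
    · subst hj; exact factorProj_apply_same _ _
    · rw [factorProj_apply_ne hj, h j hj]

lemma productProj_apply (y w : Ambient k n) (i : Fin l) :
    productProj k n y w i =
      w i - k i • semiForm (tau (k i)) (n i + nu (k i)) (y i) (w i) • y i := by
  simp [productProj]

lemma productProj_of_mem {y w : Ambient k n} (hw : w ∈ productTangent k n y) :
    productProj k n y w = w := by
  funext i
  rw [productProj_apply]
  by_cases hk : k i = 0
  · simp [hk]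
  · rw [semiForm_comm, hw i hk]
    simp

lemma ambientForm_productProj {y w z : Ambient k n} (hw : w ∈ productTangent k n y) :
    ambientForm k n w (productProj k n y z) = ambientForm k n w z := by
  rw [ambientForm_apply, ambientForm_apply]
  refine Finset.sum_congr rfl fun i _ => ?_
  rw [productProj_apply]
  by_cases hk : k i = 0
  · simp [hk]
  · simp [hw i hk]

/-- The hypothesis says that the squared lengths of the components outside factor `i` add up to
zero, and each is nonnegative and definite on the tangent space. -/
lemma factorProj_eq_self_of_ambientForm {y w : Ambient k n} (hy : y ∈ productSpace k n)
    (hw : w ∈ productTangent k n y) {i : Fin l}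
    (h : ambientForm k n w (factorProj k n i w) = ambientForm k n w w) :
    factorProj k n i w = w := by
  have h0 := fun j => semiForm_self_of_tangent (hy j) (hw j)
  rw [ambientForm_apply, ambientForm_apply, ← sub_eq_zero, ← Finset.sum_sub_distrib] at h
  have hterm : ∀ j, semiForm (tau (k j)) (n j + nu (k j)) (w j) (factorProj k n i w j) -
      semiForm (tau (k j)) (n j + nu (k j)) (w j) (w j) ≤ 0 := by
    intro j
    by_cases hj : j = i
    · subst hj; rw [factorProj_apply_same, sub_self]
    · rw [factorProj_apply_ne hj, map_zero]; linarith [(h0 j).1]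
  have h1 := (Finset.sum_eq_zero_iff_of_nonpos fun j _ => hterm j).1 h
  refine factorProj_eq_self_iff.2 fun j hj => (h0 j).2 ?_
  have := h1 j (Finset.mem_univ j)
  rw [factorProj_apply_ne hj, map_zero] at this
  linarith

end Forms
section Immersion

open Filter Topology

variable {l : ℕ} {k : Fin l → ℝ} {n : Fin l → ℕ} {m : ℕ} {M : Type*} [TopologicalSpace M]
  [ChartedSpace (EuclideanSpace ℝ (Fin m)) M] [IsManifold (𝓡 m) ∞ M]

/-! ### The product rule for the ambient inner product -/

lemma contMDiffAt_ambientForm {a b : M → Ambient k n} {x : M}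
    (ha : ContMDiffAt (𝓡 m) 𝓘(ℝ, Ambient k n) ∞ a x)
    (hb : ContMDiffAt (𝓡 m) 𝓘(ℝ, Ambient k n) ∞ b x) :
    ContMDiffAt (𝓡 m) 𝓘(ℝ, ℝ) ∞ (fun y => ambientForm k n (a y) (b y)) x :=
  ContMDiffAt.clm_apply (g := fun y => ambientFormL k n (a y))
    ((ambientFormL k n).contMDiff.contMDiffAt.comp x ha) hb

lemma mvfderiv_ambientForm {a b : M → Ambient k n} {x : M}
    (ha : MDifferentiableAt (𝓡 m) 𝓘(ℝ, Ambient k n) a x)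
    (hb : MDifferentiableAt (𝓡 m) 𝓘(ℝ, Ambient k n) b x) (u : TangentSpace (𝓡 m) x) :
    mvfderiv (𝓡 m) (fun y => ambientForm k n (a y) (b y)) x u =
      ambientForm k n (mvfderiv (𝓡 m) a x u) (b x) +
        ambientForm k n (a x) (mvfderiv (𝓡 m) b x u) :=
  mvfderiv_bilin (ambientFormL k n) ha hb u

lemma mvfderiv_apply_factor {a : M → Ambient k n} {x : M}
    (ha : MDifferentiableAt (𝓡 m) 𝓘(ℝ, Ambient k n) a x) (u : TangentSpace (𝓡 m) x) (j : Fin l) :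
    mvfderiv (𝓡 m) (fun y => a y j) x u = mvfderiv (𝓡 m) a x u j :=
  mvfderiv_clm_comp (ContinuousLinearMap.proj (R := ℝ)
    (φ := fun j : Fin l => Fin (n j + nu (k j)) → ℝ) j) ha u

lemma mvfderiv_semiForm_factor {a b : M → Ambient k n} {x : M}
    (ha : MDifferentiableAt (𝓡 m) 𝓘(ℝ, Ambient k n) a x)
    (hb : MDifferentiableAt (𝓡 m) 𝓘(ℝ, Ambient k n) b x) (u : TangentSpace (𝓡 m) x) (j : Fin l) :
    mvfderiv (𝓡 m) (fun y => semiForm (tau (k j)) (n j + nu (k j)) (a y j) (b y j)) x u =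
      semiForm (tau (k j)) (n j + nu (k j)) (mvfderiv (𝓡 m) a x u j) (b x j) +
        semiForm (tau (k j)) (n j + nu (k j)) (a x j) (mvfderiv (𝓡 m) b x u j) := by
  let B : Ambient k n →L[ℝ] Ambient k n →L[ℝ] ℝ := LinearMap.toContinuousLinearMap
    ((LinearMap.toContinuousLinearMap : (Ambient k n →ₗ[ℝ] ℝ) ≃ₗ[ℝ] _).toLinearMap ∘ₗ
      (semiForm (tau (k j)) (n j + nu (k j))).compl₁₂
        (LinearMap.proj (φ := fun j : Fin l => Fin (n j + nu (k j)) → ℝ) j)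
        (LinearMap.proj (φ := fun j : Fin l => Fin (n j + nu (k j)) → ℝ) j))
  exact mvfderiv_bilin B ha hb u

variable [RiemannianBundle fun x : M => TangentSpace (𝓡 m) x] {f : M → Ambient k n}

/-! ### Tangent and normal components -/

lemma push_eq (x : M) (u : TangentSpace (𝓡 m) x) :
    push k n m f x u = mvfderiv (𝓡 m) f x u := rfl

variable (k n m f) in
/-- The orthogonal projection of the ambient space onto the normal space of `f`. -/
noncomputable def normalProj (x : M) : Ambient k n →ₗ[ℝ] Ambient k n :=
  normalPart k n m f x ∘ₗ productProj k n (f x)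

lemma secondForm_eq (x : M) (u v : TangentSpace (𝓡 m) x) :
    secondForm k n m f x u v = normalProj k n m f x (mvfderiv (𝓡 m)
      (dirDeriv (FiberBundle.extend (EuclideanSpace ℝ (Fin m))
        (E := fun y : M => TangentSpace (𝓡 m) y) v) f) x u) := rfl

lemma normalPart_apply (x : M) (w : Ambient k n) :
    normalPart k n m f x w = w - ∑ a, ambientForm k n (push k n m f x (tangentBasis m x a)) w •
      push k n m f x (tangentBasis m x a) := by
  simp [normalPart, LinearMap.sum_apply]

lemma normalPart_of_mem {x : M} {w : Ambient k n} (hw : w ∈ normalSpace k n m f x) :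
    normalPart k n m f x w = w := by
  rw [normalPart_apply, Finset.sum_eq_zero, sub_zero]
  intro a _
  rw [ambientForm_comm, hw.2, zero_smul]

lemma normalProj_of_mem {x : M} {w : Ambient k n} (hw : w ∈ normalSpace k n m f x) :
    normalProj k n m f x w = w := by
  rw [normalProj, LinearMap.comp_apply, productProj_of_mem hw.1, normalPart_of_mem hw]

lemma ambientForm_normalPart {x : M} {ζ : Ambient k n} (hζ : ζ ∈ normalSpace k n m f x)
    (w : Ambient k n) : ambientForm k n ζ (normalPart k n m f x w) = ambientForm k n ζ w := by
  rw [normalPart_apply, map_sub, map_sum, Finset.sum_eq_zero, sub_zero]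
  intro a _
  rw [map_smul, hζ.2, smul_zero]

lemma ambientForm_normalProj {x : M} {ζ : Ambient k n} (hζ : ζ ∈ normalSpace k n m f x)
    (w : Ambient k n) : ambientForm k n ζ (normalProj k n m f x w) = ambientForm k n ζ w := by
  rw [normalProj, LinearMap.comp_apply, ambientForm_normalPart hζ, ambientForm_productProj hζ.1]

lemma factorProj_eq_self_of_mem_eigenOne {x : M} (hx : f x ∈ productSpace k n) {i : Fin l}
    {ζ : Ambient k n} (hζ : ζ ∈ eigenOne k n m f i x) : factorProj k n i ζ = ζ := by
  refine factorProj_eq_self_of_ambientForm hx hζ.1.1 ?_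
  have h : ζ - tensorT k n m f i x ζ = 0 := hζ.2
  rw [← ambientForm_normalPart hζ.1]
  exact congrArg _ (sub_eq_zero.1 h).symm

lemma mem_eigenOne_of_factorProj_eq_self {x : M} {i : Fin l} {ζ : Ambient k n}
    (hζ : ζ ∈ normalSpace k n m f x) (h : factorProj k n i ζ = ζ) :
    ζ ∈ eigenOne k n m f i x := by
  refine ⟨hζ, ?_⟩
  change ζ - normalPart k n m f x (factorProj k n i ζ) = 0
  rw [h, normalPart_of_mem hζ, sub_self]

lemma exists_inner_eq {x : M} (φ : TangentSpace (𝓡 m) x →ₗ[ℝ] ℝ) :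
    ∃ v : TangentSpace (𝓡 m) x, ∀ u : TangentSpace (𝓡 m) x, inner ℝ v u = φ u := by
  have : CompleteSpace (TangentSpace (𝓡 m) x) := FiniteDimensional.complete ℝ _
  refine ⟨(InnerProductSpace.toDual ℝ (TangentSpace (𝓡 m) x)).symm
    (LinearMap.toContinuousLinearMap φ), fun u => ?_⟩
  rw [InnerProductSpace.toDual_symm_apply]
  rfl

variable (k n m f) in
/-- The differential `f_*` at `x` as a linear map. -/
noncomputable def pushₗ (x : M) : TangentSpace (𝓡 m) x →ₗ[ℝ] Ambient k n :=
  (mvfderiv (𝓡 m) f x).toLinearMap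

lemma pushₗ_apply (x : M) (u : TangentSpace (𝓡 m) x) :
    pushₗ k n m f x u = push k n m f x u := rfl

variable (k n m f) in
/-- The field tangent to `M` that represents the tangential component of `h`. -/
noncomputable def tangentPart (h : M → Ambient k n) (x : M) : TangentSpace (𝓡 m) x :=
  (exists_inner_eq (ambientForm k n (h x) ∘ₗ pushₗ k n m f x)).choose

lemma inner_tangentPart (h : M → Ambient k n) (x : M) (u : TangentSpace (𝓡 m) x) :
    inner ℝ (tangentPart k n m f h x) u = ambientForm k n (h x) (push k n m f x u) :=
  (exists_inner_eq (ambientForm k n (h x) ∘ₗ pushₗ k n m f x)).choose_spec u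

lemma normalProj_eq_sub_push_tangentPart {h : M → Ambient k n} {x : M}
    (hx : h x ∈ productTangent k n (f x)) :
    normalProj k n m f x (h x) = h x - push k n m f x (tangentPart k n m f h x) := by
  rw [normalProj, LinearMap.comp_apply, productProj_of_mem hx, normalPart_apply]
  congr 1
  conv_rhs => rw [← (tangentBasis m x).sum_repr' (tangentPart k n m f h x)]
  rw [← pushₗ_apply, map_sum]
  refine Finset.sum_congr rfl fun a _ => ?_
  rw [map_smul, real_inner_comm, inner_tangentPart, ambientForm_comm]
  rfl

namespace IsIsometricImmersion

variable (hf : IsIsometricImmersion k n m f)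
include hf

lemma mdifferentiableAt (x : M) : MDifferentiableAt (𝓡 m) 𝓘(ℝ, Ambient k n) f x :=
  hf.smooth.mdifferentiable (by simp) x

/-- Differentiate $\langle f_j,f_j\rangle=1/k_j$. -/
lemma push_mem (x : M) (u : TangentSpace (𝓡 m) x) :
    push k n m f x u ∈ productTangent k n (f x) := by
  intro j hj
  have h := mvfderiv_semiForm_factor (hf.mdifferentiableAt x) (hf.mdifferentiableAt x) u j
  have h1 : (fun y => semiForm (tau (k j)) (n j + nu (k j)) (f y j) (f y j)) =
      fun _ => 1 / k j := funext fun y => (hf.mem y j).1 hj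
  rw [h1, mvfderiv_const, semiForm_comm _ _ (f x j)] at h
  rw [push_eq]
  have h2 : (0 : ℝ) = _ := h
  linarith

lemma normalProj_push (x : M) (u : TangentSpace (𝓡 m) x) :
    normalProj k n m f x (push k n m f x u) = 0 := by
  have h := normalProj_eq_sub_push_tangentPart (m := m) (f := f)
    (h := fun y => push k n m f y (FiberBundle.extend (EuclideanSpace ℝ (Fin m))
      (E := fun y : M => TangentSpace (𝓡 m) y) u y)) (hf.push_mem x _)
  rw [FiberBundle.extend_apply_self] at h
  rw [h, sub_eq_zero]
  congr 1
  refine ext_inner_right ℝ fun v => ?_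
  rw [inner_tangentPart, FiberBundle.extend_apply_self]
  exact (hf.isometric x u v).symm

lemma contMDiffAt_push {X : (x : M) → TangentSpace (𝓡 m) x} {x : M} (hX : IsSmoothFieldAt X x) :
    ContMDiffAt (𝓡 m) 𝓘(ℝ, Ambient k n) ∞ (dirDeriv X f) x :=
  contMDiffAt_dirDeriv hX hf.smooth

lemma isSmoothFieldAt_tangentPart
    [IsContMDiffRiemannianBundle (𝓡 m) ∞ (EuclideanSpace ℝ (Fin m))
      fun x : M => TangentSpace (𝓡 m) x] {h : M → Ambient k n} {x : M}
    (hh : ContMDiffAt (𝓡 m) 𝓘(ℝ, Ambient k n) ∞ h x) :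
    IsSmoothFieldAt (tangentPart k n m f h) x := by
  refine isSmoothFieldAt_of_inner fun Y hY => ?_
  simp only [inner_tangentPart]
  exact contMDiffAt_ambientForm hh (hf.contMDiffAt_push hY)

/-! ### The second fundamental form -/

/-- The difference is $f_*[U,V]$, which has no normal component. -/
lemma normalProj_dirDeriv_comm {U V : (x : M) → TangentSpace (𝓡 m) x} {x : M}
    (hU : IsSmoothFieldAt U x) (hV : IsSmoothFieldAt V x) :
    normalProj k n m f x (dirDeriv U (dirDeriv V f) x) =
      normalProj k n m f x (dirDeriv V (dirDeriv U f) x) := by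
  rw [← sub_eq_zero, ← map_sub, dirDeriv_mlieBracket hU hV hf.smooth]
  exact hf.normalProj_push x _

/-- `secondForm` is defined through one particular extension; this frees it from that choice. After
swapping the two derivatives, only the value `V x` enters, so `V` may be replaced by the chosen
extension before swapping back. -/
lemma normalProj_dirDeriv {V : (x : M) → TangentSpace (𝓡 m) x} {x : M}
    (hV : IsSmoothFieldAt V x) (u : TangentSpace (𝓡 m) x) :
    normalProj k n m f x (mvfderiv (𝓡 m) (dirDeriv V f) x u) =
      secondForm k n m f x u (V x) := by
  have h1 := hf.normalProj_dirDeriv_comm (isSmoothFieldAt_extend u) hV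
  have h2 := hf.normalProj_dirDeriv_comm (isSmoothFieldAt_extend u)
    (isSmoothFieldAt_extend (V x))
  simp only [dirDeriv_apply, FiberBundle.extend_apply_self] at h1 h2
  rw [h1, ← h2]
  rfl

lemma secondForm_comm (x : M) (u v : TangentSpace (𝓡 m) x) :
    secondForm k n m f x u v = secondForm k n m f x v u := by
  have h2 := hf.normalProj_dirDeriv_comm (isSmoothFieldAt_extend u) (isSmoothFieldAt_extend v)
  simp only [dirDeriv_apply, FiberBundle.extend_apply_self] at h2
  exact h2

/-! ### The Levi-Civita connection -/

lemma inner_eq (x : M) (u v : TangentSpace (𝓡 m) x) :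
    inner ℝ u v = ambientForm k n (mvfderiv (𝓡 m) f x u) (mvfderiv (𝓡 m) f x v) :=
  (hf.isometric x u v).symm

/-- Write the metric as $\langle f_*\cdot,f_*\cdot\rangle$ and brackets as commutators of `D`: all
second derivatives of `f` cancel except $D_XD_Yf$. -/
lemma koszul_eq {X Y Z : (x : M) → TangentSpace (𝓡 m) x} {x : M}
    (hX : IsSmoothFieldAt X x) (hY : IsSmoothFieldAt Y x) (hZ : IsSmoothFieldAt Z x) :
    koszul X Y Z x =
      2 * ambientForm k n (dirDeriv X (dirDeriv Y f) x) (dirDeriv Z f x) := by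
  have hdiff : ∀ {W : (x : M) → TangentSpace (𝓡 m) x}, IsSmoothFieldAt W x →
      MDifferentiableAt (𝓡 m) 𝓘(ℝ, Ambient k n) (dirDeriv W f) x :=
    fun hW => (hf.contMDiffAt_push hW).mdifferentiableAt (by simp)
  have hprod : ∀ {U V W : (x : M) → TangentSpace (𝓡 m) x}, IsSmoothFieldAt V x →
      IsSmoothFieldAt W x →
      mvfderiv (𝓡 m) (fun y : M => inner ℝ (V y) (W y)) x (U x) =
        ambientForm k n (dirDeriv U (dirDeriv V f) x) (dirDeriv W f x) +
          ambientForm k n (dirDeriv V f x) (dirDeriv U (dirDeriv W f) x) := by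
    intro U V W hV hW
    have h : (fun y : M => inner ℝ (V y) (W y)) =
        fun y => ambientForm k n (dirDeriv V f y) (dirDeriv W f y) :=
      funext fun y => hf.inner_eq y _ _
    rw [h]
    exact mvfderiv_ambientForm (hdiff hV) (hdiff hW) (U x)
  have hbr : ∀ {U V W : (x : M) → TangentSpace (𝓡 m) x}, IsSmoothFieldAt U x →
      IsSmoothFieldAt V x →
      inner ℝ (VectorField.mlieBracket (𝓡 m) U V x) (W x) =
        ambientForm k n (dirDeriv U (dirDeriv V f) x) (dirDeriv W f x) -
          ambientForm k n (dirDeriv V (dirDeriv U f) x) (dirDeriv W f x) := by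
    intro U V W hU hV
    have h := dirDeriv_mlieBracket hU hV hf.smooth
    rw [hf.inner_eq, ← dirDeriv_apply, ← dirDeriv_apply, ← h, map_sub, LinearMap.sub_apply]
  rw [koszul, hprod hY hZ, hprod hX hZ, hprod hX hY, hbr hX hY, hbr hX hZ, hbr hY hZ,
    ambientForm_comm (dirDeriv Y f x), ambientForm_comm (dirDeriv X f x),
    ambientForm_comm (dirDeriv X f x)]
  ring

/-- The tangential part of $D_XD_Yf$ satisfies the Koszul condition, so the chosen value does too;
testing on extensions of tangent vectors shows that they agree. -/
lemma leviCivita_eq {X Y : (x : M) → TangentSpace (𝓡 m) x} {x : M}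
    (hX : IsSmoothFieldAt X x) (hY : IsSmoothFieldAt Y x) :
    leviCivita X Y x = tangentPart k n m f (dirDeriv X (dirDeriv Y f)) x := by
  have hex : ∀ Z : (y : M) → TangentSpace (𝓡 m) y, IsSmoothFieldAt Z x →
      2 * inner ℝ (tangentPart k n m f (dirDeriv X (dirDeriv Y f)) x) (Z x) =
        koszul X Y Z x := by
    intro Z hZ
    rw [hf.koszul_eq hX hY hZ, inner_tangentPart]
    rfl
  have hlc : ∀ Z : (y : M) → TangentSpace (𝓡 m) y, IsSmoothFieldAt Z x →
      2 * inner ℝ (leviCivita X Y x) (Z x) = koszul X Y Z x :=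
    Classical.epsilon_spec (p := fun v : TangentSpace (𝓡 m) x =>
      ∀ Z : (y : M) → TangentSpace (𝓡 m) y,
        ContMDiffAt (𝓡 m) (𝓡 m).tangent ∞ (fun y => (⟨y, Z y⟩ : TangentBundle (𝓡 m) M)) x →
        2 * inner ℝ v (Z x) = koszul X Y Z x) ⟨_, hex⟩
  refine ext_inner_right ℝ fun u => ?_
  have h := (hlc _ (isSmoothFieldAt_extend u)).trans (hex _ (isSmoothFieldAt_extend u)).symm
  rw [FiberBundle.extend_apply_self] at h
  linarith

lemma isSmoothField_leviCivita
    [IsContMDiffRiemannianBundle (𝓡 m) ∞ (EuclideanSpace ℝ (Fin m))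
      fun x : M => TangentSpace (𝓡 m) x]
    {X Y : (x : M) → TangentSpace (𝓡 m) x} (hX : IsSmoothField X) (hY : IsSmoothField Y) :
    IsSmoothField (leviCivita X Y) := by
  have h : leviCivita X Y = tangentPart k n m f (dirDeriv X (dirDeriv Y f)) :=
    funext fun x => hf.leviCivita_eq (hX.at x) (hY.at x)
  rw [h]
  intro x
  refine hf.isSmoothFieldAt_tangentPart (contMDiffAt_dirDeriv (hX.at x) fun y => ?_)
  exact hf.contMDiffAt_push (hY.at y)

end IsIsometricImmersion
end Immersion
section Immersion

open Filter Topology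

variable {l : ℕ} {k : Fin l → ℝ} {n : Fin l → ℕ} {m : ℕ} {M : Type*} [TopologicalSpace M]
  [ChartedSpace (EuclideanSpace ℝ (Fin m)) M] [IsManifold (𝓡 m) ∞ M]
  [RiemannianBundle fun x : M => TangentSpace (𝓡 m) x] {f : M → Ambient k n} {i : Fin l}

/-! ### Normal fields tangent to a factor -/

variable (k n m f i) in
/-- `ξ` is a smooth section of the normal bundle that is tangent to the `i`-th factor. -/
structure IsFactorField (ξ : M → Ambient k n) : Prop where
  smooth : ContMDiff (𝓡 m) 𝓘(ℝ, Ambient k n) ∞ ξ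
  mem_normalSpace (x : M) : ξ x ∈ normalSpace k n m f x
  factorProj_eq (x : M) : factorProj k n i (ξ x) = ξ x

namespace IsFactorField

variable {ξ : M → Ambient k n} (hξ : IsFactorField k n m f i ξ)
include hξ

lemma mdifferentiableAt (x : M) : MDifferentiableAt (𝓡 m) 𝓘(ℝ, Ambient k n) ξ x :=
  hξ.smooth.mdifferentiable (by simp) x

lemma factorProj_mvfderiv (x : M) (u : TangentSpace (𝓡 m) x) :
    factorProj k n i (mvfderiv (𝓡 m) ξ x u) = mvfderiv (𝓡 m) ξ x u := by
  refine factorProj_eq_self_iff.2 fun j hj => ?_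
  rw [← mvfderiv_apply_factor (hξ.mdifferentiableAt x)]
  have h : (fun y => ξ y j) = fun _ => 0 :=
    funext fun y => factorProj_eq_self_iff.1 (hξ.factorProj_eq y) j hj
  rw [h, mvfderiv_const]
  rfl

/-- Differentiate $\langle\xi_i,f_i\rangle=0$. The term $\langle\xi_i,(f_*u)_i\rangle$ equals
$\langle\xi,f_*u\rangle=0$ because $\xi$ has no other components. -/
lemma mvfderiv_mem (hf : IsIsometricImmersion k n m f) (x : M) (u : TangentSpace (𝓡 m) x) :
    mvfderiv (𝓡 m) ξ x u ∈ productTangent k n (f x) := by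
  intro j hj
  by_cases hji : j = i
  · subst hji
    have h := mvfderiv_semiForm_factor (hξ.mdifferentiableAt x) (hf.mdifferentiableAt x) u j
    have h1 : (fun y => semiForm (tau (k j)) (n j + nu (k j)) (ξ y j) (f y j)) = fun _ => 0 :=
      funext fun y => (hξ.mem_normalSpace y).1 j hj
    have h2 : semiForm (tau (k j)) (n j + nu (k j)) (ξ x j) (mvfderiv (𝓡 m) f x u j) = 0 := by
      have h3 := (hξ.mem_normalSpace x).2 u
      rw [ambientForm_apply, Finset.sum_eq_single j] at h3
      · exact h3
      · intro b _ hb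
        rw [factorProj_eq_self_iff.1 (hξ.factorProj_eq x) b hb, map_zero, LinearMap.zero_apply]
      · simp
    rw [h1, mvfderiv_const, h2, add_zero] at h
    exact h.symm
  · rw [factorProj_eq_self_iff.1 (hξ.factorProj_mvfderiv x u) j hji, map_zero,
      LinearMap.zero_apply]

/-- The Weingarten formula, from differentiating $\langle\xi,f_*V\rangle=0$. -/
lemma ambientForm_mvfderiv_push (hf : IsIsometricImmersion k n m f) (x : M)
    (u v : TangentSpace (𝓡 m) x) :
    ambientForm k n (mvfderiv (𝓡 m) ξ x u) (push k n m f x v) =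
      -ambientForm k n (ξ x) (secondForm k n m f x u v) := by
  have hV := isSmoothFieldAt_extend v
  have h := mvfderiv_ambientForm (hξ.mdifferentiableAt x)
    ((hf.contMDiffAt_push hV).mdifferentiableAt (by simp)) u
  have h1 : (fun y => ambientForm k n (ξ y) (dirDeriv (FiberBundle.extend
      (EuclideanSpace ℝ (Fin m)) (E := fun y : M => TangentSpace (𝓡 m) y) v) f y)) = fun _ => 0 :=
    funext fun y => (hξ.mem_normalSpace y).2 _
  rw [h1, mvfderiv_const, dirDeriv_apply, FiberBundle.extend_apply_self,
    ← ambientForm_normalProj (hξ.mem_normalSpace x)] at h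
  rw [secondForm_eq, push_eq]
  exact eq_neg_of_add_eq_zero_left h.symm

/-- The Ricci equation, for a normal field tangent to a factor. -/
lemma normalCurv_eq (hf : IsIsometricImmersion k n m f)
    [IsContMDiffRiemannianBundle (𝓡 m) ∞ (EuclideanSpace ℝ (Fin m))
      fun x : M => TangentSpace (𝓡 m) x]
    {X Y : (x : M) → TangentSpace (𝓡 m) x} (hX : IsSmoothField X) (hY : IsSmoothField Y) (x : M) :
    normalCurv k n m f X Y ξ x =
      secondForm k n m f x (Y x) (tangentPart k n m f (dirDeriv X ξ) x) -
        secondForm k n m f x (X x) (tangentPart k n m f (dirDeriv Y ξ) x) := by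
  have hD : ∀ X : (x : M) → TangentSpace (𝓡 m) x, normalDeriv k n m f X ξ =
      dirDeriv X ξ - dirDeriv (tangentPart k n m f (dirDeriv X ξ)) f := fun X =>
    funext fun y => normalProj_eq_sub_push_tangentPart (h := dirDeriv X ξ)
      (hξ.mvfderiv_mem hf y (X y))
  have hDD : ∀ X Y : (x : M) → TangentSpace (𝓡 m) x, IsSmoothField Y →
      normalDeriv k n m f X (normalDeriv k n m f Y ξ) x =
        normalProj k n m f x (dirDeriv X (dirDeriv Y ξ) x) -
          secondForm k n m f x (X x) (tangentPart k n m f (dirDeriv Y ξ) x) := by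
    intro X Y hY
    have hs : ContMDiffAt (𝓡 m) 𝓘(ℝ, Ambient k n) ∞ (dirDeriv Y ξ) x :=
      contMDiffAt_dirDeriv (hY.at x) hξ.smooth
    have ht := hf.isSmoothFieldAt_tangentPart hs
    rw [hD Y]
    change normalProj k n m f x (mvfderiv (𝓡 m) (_ - _) x (X x)) = _
    rw [mvfderiv_sub (hs.mdifferentiableAt (by simp))
      ((hf.contMDiffAt_push ht).mdifferentiableAt (by simp)), sub_apply, map_sub,
      hf.normalProj_dirDeriv ht]
    rfl
  -- Flatness of `D` cancels the second derivatives of `ξ`, so no curvature term of the product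
  -- remains.
  have hbr := dirDeriv_mlieBracket (hX.at x) (hY.at x) hξ.smooth
  change normalDeriv k n m f X (normalDeriv k n m f Y ξ) x -
    normalDeriv k n m f Y (normalDeriv k n m f X ξ) x -
      normalProj k n m f x (dirDeriv (VectorField.mlieBracket (𝓡 m) X Y) ξ x) = _
  rw [hDD X Y hY, hDD Y X hX, ← hbr, map_sub]
  abel

end IsFactorField

/-! ### Sections of `V_i ∩ N₁^⊥` -/

/-- When $D_z\xi$ is normal, `b` is $A_{D_z\xi}\,y$. With the extension of `y` fixed, the right side
is visibly linear in `u`. -/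
lemma exists_shape (ξ : M → Ambient k n) (x : M) (z y : TangentSpace (𝓡 m) x) :
    ∃ b : TangentSpace (𝓡 m) x, ∀ u : TangentSpace (𝓡 m) x,
      inner ℝ b u = ambientForm k n (mvfderiv (𝓡 m) ξ x z) (secondForm k n m f x u y) := by
  let φ : TangentSpace (𝓡 m) x →ₗ[ℝ] ℝ := ambientForm k n (mvfderiv (𝓡 m) ξ x z) ∘ₗ
    normalProj k n m f x ∘ₗ (mvfderiv (𝓡 m) (dirDeriv
      (FiberBundle.extend (EuclideanSpace ℝ (Fin m)) (E := fun y : M => TangentSpace (𝓡 m) y) y)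
        f) x).toLinearMap
  exact exists_inner_eq φ

namespace IsSmoothSection

variable {ξ : M → Ambient k n} (hξ : IsSmoothSection m (eigenPerp k n m f i) ξ)
  (hf : IsIsometricImmersion k n m f)
include hξ hf

lemma isFactorField : IsFactorField k n m f i ξ where
  smooth := hξ.1
  mem_normalSpace x := (hξ.2 x).1.1
  factorProj_eq x := factorProj_eq_self_of_mem_eigenOne (hf.mem x) (hξ.2 x).1

lemma mvfderiv_mem_normalSpace (x : M) (u : TangentSpace (𝓡 m) x) :
    mvfderiv (𝓡 m) ξ x u ∈ normalSpace k n m f x := by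
  refine ⟨(hξ.isFactorField hf).mvfderiv_mem hf x u, fun v => ?_⟩
  rw [(hξ.isFactorField hf).ambientForm_mvfderiv_push hf,
    (hξ.2 x).2.2 _ (Submodule.subset_span ⟨u, v, rfl⟩), neg_zero]

lemma normalConn_eq_mvfderiv (x : M) (u : TangentSpace (𝓡 m) x) :
    normalConn k n m f ξ x u = mvfderiv (𝓡 m) ξ x u :=
  normalProj_of_mem (hξ.mvfderiv_mem_normalSpace hf x u)

lemma normalDeriv_eq_dirDeriv (X : (x : M) → TangentSpace (𝓡 m) x) :
    normalDeriv k n m f X ξ = dirDeriv X ξ :=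
  funext fun x => hξ.normalConn_eq_mvfderiv hf x (X x)

lemma dirDeriv {X : (x : M) → TangentSpace (𝓡 m) x} (hX : IsSmoothField X) :
    IsFactorField k n m f i (dirDeriv X ξ) where
  smooth x := contMDiffAt_dirDeriv (hX.at x) hξ.1
  mem_normalSpace x := hξ.mvfderiv_mem_normalSpace hf x (X x)
  factorProj_eq x := (hξ.isFactorField hf).factorProj_mvfderiv x (X x)

lemma normalCurv_eq_zero {X Y : (x : M) → TangentSpace (𝓡 m) x} (hX : IsSmoothField X)
    (hY : IsSmoothField Y) : normalCurv k n m f X Y ξ = 0 := by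
  funext x
  rw [normalCurv]
  simp only [hξ.normalDeriv_eq_dirDeriv hf]
  have h := normalProj_of_mem
    (hξ.mvfderiv_mem_normalSpace hf x (VectorField.mlieBracket (𝓡 m) X Y x))
  rw [← dirDeriv_apply, ← dirDeriv_mlieBracket (hX.at x) (hY.at x) hξ.1, map_sub] at h
  change normalProj k n m f x (SpaceFormProduct.dirDeriv X (SpaceFormProduct.dirDeriv Y ξ) x) -
    normalProj k n m f x (SpaceFormProduct.dirDeriv Y (SpaceFormProduct.dirDeriv X ξ) x) -
      SpaceFormProduct.dirDeriv (VectorField.mlieBracket (𝓡 m) X Y) ξ x = 0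
  rw [h, dirDeriv_mlieBracket (hX.at x) (hY.at x) hξ.1, sub_self]

/-- The three terms in which $\mathcal R^\perp$ acts on `ξ` itself vanish; smoothness of $\nabla_ZX$
and $\nabla_ZY$ is needed for two of them. -/
lemma normalCurvDeriv_eq
    [IsContMDiffRiemannianBundle (𝓡 m) ∞ (EuclideanSpace ℝ (Fin m))
      fun x : M => TangentSpace (𝓡 m) x] {X Y Z : (x : M) → TangentSpace (𝓡 m) x}
    (hX : IsSmoothField X) (hY : IsSmoothField Y) (hZ : IsSmoothField Z) :
    normalCurvDeriv k n m f Z X Y ξ =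
      -normalCurv k n m f X Y (SpaceFormProduct.dirDeriv Z ξ) := by
  have h0 : normalDeriv k n m f Z (0 : M → Ambient k n) = 0 := by
    funext x
    change normalProj k n m f x (mvfderiv (𝓡 m) (0 : M → Ambient k n) x (Z x)) = 0
    rw [mvfderiv_zero, zero_apply, map_zero]
  rw [normalCurvDeriv, hξ.normalCurv_eq_zero hf hX hY, h0,
    hξ.normalCurv_eq_zero hf (hf.isSmoothField_leviCivita hZ hX) hY,
    hξ.normalCurv_eq_zero hf hX (hf.isSmoothField_leviCivita hZ hY),
    hξ.normalDeriv_eq_dirDeriv hf]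
  simp

/-- A Codazzi-type symmetry. Differentiating $\langle D_U\xi,f_*W\rangle=0$ along `v` turns each
side into a second derivative of `ξ`; their difference is $D_{[V,U]}\xi$ up to sign, which is
normal. -/
lemma ambientForm_mvfderiv_secondForm_comm (x : M) (u v w : TangentSpace (𝓡 m) x) :
    ambientForm k n (mvfderiv (𝓡 m) ξ x u) (secondForm k n m f x v w) =
      ambientForm k n (mvfderiv (𝓡 m) ξ x v) (secondForm k n m f x u w) := by
  have key : ∀ u v : TangentSpace (𝓡 m) x,
      ambientForm k n (mvfderiv (𝓡 m) ξ x u) (secondForm k n m f x v w) =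
        -ambientForm k n (SpaceFormProduct.dirDeriv (FiberBundle.extend (EuclideanSpace ℝ (Fin m))
          (E := fun y : M => TangentSpace (𝓡 m) y) v) (SpaceFormProduct.dirDeriv
            (FiberBundle.extend (EuclideanSpace ℝ (Fin m))
              (E := fun y : M => TangentSpace (𝓡 m) y) u) ξ) x) (push k n m f x w) := by
    intro u v
    have hU := isSmoothFieldAt_extend u
    have hW := isSmoothFieldAt_extend w
    have h := mvfderiv_ambientForm ((contMDiffAt_dirDeriv hU hξ.1).mdifferentiableAt (by simp))
      ((hf.contMDiffAt_push hW).mdifferentiableAt (by simp)) v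
    have h1 : (fun y => ambientForm k n (SpaceFormProduct.dirDeriv (FiberBundle.extend
        (EuclideanSpace ℝ (Fin m)) (E := fun y : M => TangentSpace (𝓡 m) y) u) ξ y)
          (SpaceFormProduct.dirDeriv (FiberBundle.extend (EuclideanSpace ℝ (Fin m))
            (E := fun y : M => TangentSpace (𝓡 m) y) w) f y)) = fun _ => 0 :=
      funext fun y => (hξ.mvfderiv_mem_normalSpace hf y _).2 _
    rw [h1, mvfderiv_const, dirDeriv_apply, FiberBundle.extend_apply_self, dirDeriv_apply,
      FiberBundle.extend_apply_self,
      ← ambientForm_normalProj (hξ.mvfderiv_mem_normalSpace hf x u)] at h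
    rw [secondForm_eq, push_eq, dirDeriv_apply, FiberBundle.extend_apply_self]
    exact eq_neg_of_add_eq_zero_right h.symm
  rw [key u v, key v u, neg_inj, ← sub_eq_zero, ← LinearMap.sub_apply, ← map_sub,
    dirDeriv_mlieBracket (isSmoothFieldAt_extend v) (isSmoothFieldAt_extend u) hξ.1]
  exact (hξ.mvfderiv_mem_normalSpace hf x _).2 w

/-- If the normal curvature annihilates `∇^⊥ ξ` and `∇^⊥ ξ` is orthogonal to the mean curvature
vector, then `∇^⊥ ξ` is orthogonal to the first normal space. -/
lemma ambientForm_mvfderiv_secondForm_eq_zero [T2Space M]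
    [IsContMDiffRiemannianBundle (𝓡 m) ∞ (EuclideanSpace ℝ (Fin m))
      fun x : M => TangentSpace (𝓡 m) x]
    (x : M)
    (hR : ∀ X Y Z : (x : M) → TangentSpace (𝓡 m) x, IsSmoothField X → IsSmoothField Y →
      IsSmoothField Z → normalCurv k n m f X Y (SpaceFormProduct.dirDeriv Z ξ) x = 0)
    (hη : ∀ u : TangentSpace (𝓡 m) x, ∑ a, ambientForm k n (mvfderiv (𝓡 m) ξ x u)
      (secondForm k n m f x (tangentBasis m x a) (tangentBasis m x a)) = 0)
    (u v w : TangentSpace (𝓡 m) x) :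
    ambientForm k n (mvfderiv (𝓡 m) ξ x u) (secondForm k n m f x v w) = 0 := by
  choose B hB using exists_shape (m := m) (f := f) ξ x
  have hBsymm : ∀ z y : TangentSpace (𝓡 m) x, B z y = B y z := by
    intro z y
    refine ext_inner_right ℝ fun u => ?_
    rw [hB, hB, hf.secondForm_comm x u y, hf.secondForm_comm x u z,
      hξ.ambientForm_mvfderiv_secondForm_comm hf]
  -- The Ricci equation for $D_Z\xi$, paired with $D_w\xi$: the shape operators commute.
  have hcomm : ∀ w a z y : TangentSpace (𝓡 m) x,
      (inner ℝ (B w a) (B z y) : ℝ) = inner ℝ (B w y) (B z a) := by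
    intro w a z y
    obtain ⟨X, hX, rfl⟩ := exists_isSmoothField_apply_eq a
    obtain ⟨Y, hY, rfl⟩ := exists_isSmoothField_apply_eq y
    obtain ⟨Z, hZ, rfl⟩ := exists_isSmoothField_apply_eq z
    have hζ := hξ.dirDeriv hf hZ
    have hT : ∀ X : (x : M) → TangentSpace (𝓡 m) x,
        tangentPart k n m f (SpaceFormProduct.dirDeriv X (SpaceFormProduct.dirDeriv Z ξ)) x =
          -B (Z x) (X x) := by
      intro X
      refine ext_inner_right ℝ fun u => ?_
      rw [inner_tangentPart, inner_neg_left, hB, hf.secondForm_comm]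
      exact hζ.ambientForm_mvfderiv_push hf x (X x) u
    have h := hR X Y Z hX hY hZ
    rw [hζ.normalCurv_eq hf hX hY, hT, hT] at h
    have h1 := congrArg (ambientForm k n (mvfderiv (𝓡 m) ξ x w)) h
    rw [map_sub, map_zero, hf.secondForm_comm, hf.secondForm_comm x (X x), ← hB, ← hB,
      inner_neg_right, inner_neg_right] at h1
    linarith
  -- Orthogonality to the mean curvature is applied in the direction $B(u,u)$.
  have hsum : ∑ a, (inner ℝ (B u (tangentBasis m x a)) (B u (tangentBasis m x a)) : ℝ) = 0 := by
    rw [← hη (B u u)]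
    refine Finset.sum_congr rfl fun a _ => ?_
    rw [hξ.ambientForm_mvfderiv_secondForm_comm hf, ← hB]
    have h := hcomm (tangentBasis m x a) u u (tangentBasis m x a)
    rwa [hBsymm _ u] at h
  have hzero : ∀ a, B u (tangentBasis m x a) = 0 := by
    intro a
    have h := (Finset.sum_eq_zero_iff_of_nonneg fun a _ => real_inner_self_nonneg).1 hsum a
      (Finset.mem_univ a)
    exact inner_self_eq_zero.1 h
  -- Symmetry of $\alpha$ moves `w` to the other slot, so linearity of `B` is not needed.
  have hBw : B u w = 0 := by
    rw [← (tangentBasis m x).sum_repr' (B u w)]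
    refine Finset.sum_eq_zero fun a _ => ?_
    rw [real_inner_comm, hB, hf.secondForm_comm, ← hB, hzero, inner_zero_left, zero_smul]
  rw [← hB u w, hBw, inner_zero_left]

end IsSmoothSection

end Immersion
end SpaceFormProduct

/-! ### The equivalence -/

theorem theorem4p4 {l : ℕ} (k : Fin l → ℝ) (n : Fin l → ℕ) {m : ℕ} {M : Type*}
    [TopologicalSpace M] [T2Space M] [SecondCountableTopology M]
    [ChartedSpace (EuclideanSpace ℝ (Fin m)) M] [IsManifold (𝓡 m) ∞ M]
    [RiemannianBundle fun x : M => TangentSpace (𝓡 m) x]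
    [IsContMDiffRiemannianBundle (𝓡 m) ∞ (EuclideanSpace ℝ (Fin m))
      fun x : M => TangentSpace (𝓡 m) x]
    (f : M → SpaceFormProduct.Ambient k n)
    (hf : SpaceFormProduct.IsIsometricImmersion k n m f)
    (i : Fin l)
    (hsub : SpaceFormProduct.IsSubbundle m (SpaceFormProduct.eigenPerp k n m f i)) :
    (∀ ξ : M → SpaceFormProduct.Ambient k n,
      SpaceFormProduct.IsSmoothSection m (SpaceFormProduct.eigenPerp k n m f i) ξ →
      ∀ (x : M) (u : TangentSpace (𝓡 m) x),
        SpaceFormProduct.normalConn k n m f ξ x u ∈ SpaceFormProduct.firstNormalPerp k n m f x) ↔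
    ((∀ X Y Z : (x : M) → TangentSpace (𝓡 m) x,
        SpaceFormProduct.IsSmoothField X → SpaceFormProduct.IsSmoothField Y →
        SpaceFormProduct.IsSmoothField Z →
        ∀ ξ : M → SpaceFormProduct.Ambient k n,
          SpaceFormProduct.IsSmoothSection m (SpaceFormProduct.eigenPerp k n m f i) ξ →
          ∀ x : M, SpaceFormProduct.normalCurvDeriv k n m f Z X Y ξ x = 0) ∧
      (∀ ξ : M → SpaceFormProduct.Ambient k n,
        SpaceFormProduct.IsSmoothSection m (SpaceFormProduct.eigenPerp k n m f i) ξ →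
        ∀ (x : M) (u : TangentSpace (𝓡 m) x),
          SpaceFormProduct.ambientForm k n (SpaceFormProduct.normalConn k n m f ξ x u)
            (SpaceFormProduct.meanCurvature k n m f x) = 0)) := by
  constructor
  · intro h
    have hη : ∀ x, SpaceFormProduct.meanCurvature k n m f x ∈
        SpaceFormProduct.firstNormal k n m f x := fun x =>
      Submodule.smul_mem _ _ (Submodule.sum_mem _ fun a _ => Submodule.subset_span ⟨_, _, rfl⟩)
    refine ⟨fun X Y Z hX hY hZ ξ hξ x => ?_, fun ξ hξ x u => (h ξ hξ x u).2 _ (hη x)⟩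
    -- Parallelism makes $D_Z\xi$ a section of the same bundle, so the normal curvature annihilates
    -- it as well.
    have hζ : SpaceFormProduct.IsSmoothSection m (SpaceFormProduct.eigenPerp k n m f i)
        (SpaceFormProduct.dirDeriv Z ξ) := by
      have hF := hξ.dirDeriv hf hZ
      refine ⟨hF.smooth, fun y => ⟨SpaceFormProduct.mem_eigenOne_of_factorProj_eq_self
        (hF.mem_normalSpace y) (hF.factorProj_eq y), ?_⟩⟩
      rw [← hξ.normalDeriv_eq_dirDeriv hf]
      exact h ξ hξ y (Z y)
    rw [hξ.normalCurvDeriv_eq hf hX hY hZ, hζ.normalCurv_eq_zero hf hX hY, neg_zero]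
    rfl
  · rintro ⟨hR, hη⟩ ξ hξ x u
    have hη' : ∀ u : TangentSpace (𝓡 m) x,
        ∑ a, SpaceFormProduct.ambientForm k n (mvfderiv (𝓡 m) ξ x u)
          (SpaceFormProduct.secondForm k n m f x (SpaceFormProduct.tangentBasis m x a)
            (SpaceFormProduct.tangentBasis m x a)) = 0 := by
      intro u
      have h := hη ξ hξ x u
      rw [hξ.normalConn_eq_mvfderiv hf, SpaceFormProduct.meanCurvature, map_smul, map_sum,
        smul_eq_mul, mul_eq_zero] at h
      -- For `m = 0` the factor `1 / m` is `0` and (II) carries no information, but the trace is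
      -- then an empty sum.
      refine h.elim (fun hm => ?_) id
      have hm0 : m = 0 := by simpa using hm
      have hrank : Module.finrank ℝ (TangentSpace (𝓡 m) x) = m := finrank_euclideanSpace_fin
      have : IsEmpty (Fin (Module.finrank ℝ (TangentSpace (𝓡 m) x))) := by
        rw [hrank, hm0]
        infer_instance
      exact Finset.sum_eq_zero fun a _ => isEmptyElim a
    have hR' : ∀ X Y Z : (x : M) → TangentSpace (𝓡 m) x, SpaceFormProduct.IsSmoothField X →
        SpaceFormProduct.IsSmoothField Y → SpaceFormProduct.IsSmoothField Z →
        SpaceFormProduct.normalCurv k n m f X Y (SpaceFormProduct.dirDeriv Z ξ) x = 0 := by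
      intro X Y Z hX hY hZ
      have h := hR X Y Z hX hY hZ ξ hξ x
      rw [hξ.normalCurvDeriv_eq hf hX hY hZ] at h
      exact neg_eq_zero.1 h
    have hN := hξ.ambientForm_mvfderiv_secondForm_eq_zero hf x hR' hη' u
    rw [hξ.normalConn_eq_mvfderiv hf]
    refine ⟨hξ.mvfderiv_mem_normalSpace hf x u, fun z hz => ?_⟩
    have hle : SpaceFormProduct.firstNormal k n m f x ≤
        LinearMap.ker (SpaceFormProduct.ambientForm k n (mvfderiv (𝓡 m) ξ x u)) := by
      refine Submodule.span_le.2 ?_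
      rintro _ ⟨v, w, rfl⟩
      exact hN v w
    exact hle hz
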